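/- Fix $L>0$ and $p>1$. Let $W$ be the set of all $(t|n|b)\in W^{1,p}((0,L);SO(3))$ (that is, $t,n,b\in W^{1,p}((0,L);\mathbb R^3)$ and $(t(s),n(s),b(s))$ is a positively oriented orthonormal basis of $\mathbb R^3$ for every $s$) such that $$t'\cdot b=0 \ \text{ a.e. on } (0,L),\qquad \int_0^L t\,ds=0,\qquad t(L)=t(0),$$ where elements of $W^{1,p}$ are identified with their continuous representatives on $[0,L]$. For $(t|n|b)\in W$ let $\kappa=t'\cdot n$ and $\tau=n'\cdot b$ (weak derivatives), and define $\mathcal E\colon W\to\mathbb R\cup\{+\infty\}$ by $$\mathcal E(t|n|b)=\int_0^L\kappa^2\,ds .$$ **Theorem.** Let $(t|n|b)\in W$ be a minimizer of $\mathcal E$ on $W$. Then the set $S=\{s\in[0,L]:\kappa(s)=0\}$ has Lebesgue measure zero. Moreover $\kappa\in W^{2,2}(0,L)$ and $\tau\in W^{1,2}(0,L)$, the continuous representative of $\kappa$ is of class $C^2$ on $[0,L]$, and there exist constants $c_1,c_2\in\mathbb R$ such that, for the continuous representatives of $\kappa$ and $\tau$, $$2\kappa''-2\kappa\tau^2+\kappa^3-c_1\kappa=0,\qquad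 \kappa^2\tau=c_2\qquad\text{everywhere on }[0,L]$$ (with one-sided derivatives at the end points). -/

import Mathlib

open MeasureTheory Set
open scoped ENNReal ContDiff

noncomputable section

/-- Euclidean three-space. -/
abbrev E3 : Type := EuclideanSpace ℝ (Fin 3)

/-- `g` is a weak derivative of `u` on the open interval `(0, L)`. -/
structure IsWeakDeriv {E : Type*} [NormedAddCommGroup E] [NormedSpace ℝ E]
    (L : ℝ) (u g : ℝ → E) : Prop where
  locallyIntegrable : LocallyIntegrableOn u (Ioo 0 L)
  locallyIntegrable_deriv : LocallyIntegrableOn g (Ioo 0 L)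
  integral_eq : ∀ φ : ℝ → ℝ, ContDiff ℝ ∞ φ → HasCompactSupport φ → tsupport φ ⊆ Ioo 0 L →
    ∫ s in Ioo 0 L, deriv φ s • u s = -∫ s in Ioo 0 L, φ s • g s

open Classical in
/-- The weak derivative of `u` on `(0, L)`, which is unique up to almost everywhere equality
on `(0, L)`; it is `0` by convention if `u` has none. -/
def weakDeriv {E : Type*} [NormedAddCommGroup E] [NormedSpace ℝ E]
    (L : ℝ) (u : ℝ → E) : ℝ → E :=
  if h : ∃ g, IsWeakDeriv L u g then h.choose else 0

/-- `u` belongs to the Sobolev space `W^{k,p}((0, L); E)`: `u` and its weak derivatives up to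
order `k` exist and lie in `L^p`. -/
def MemSobolev {E : Type*} [NormedAddCommGroup E] [NormedSpace ℝ E]
    (L : ℝ) (p : ℝ≥0∞) : ℕ → (ℝ → E) → Prop
  | 0, u => MemLp u p (volume.restrict (Ioo 0 L))
  | k + 1, u => MemLp u p (volume.restrict (Ioo 0 L)) ∧
      ∃ g : ℝ → E, IsWeakDeriv L u g ∧ MemSobolev L p k g

/-- A triple `(t|n|b)` of vector fields along an interval. Only the values on `[0, L]` matter
below. -/
structure Frame where
  t : ℝ → E3
  n : ℝ → E3
  b : ℝ → E3

namespace Frame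

/-- The matrix whose columns are `t s`, `n s`, `b s`. -/
def toMatrix (F : Frame) (s : ℝ) : Matrix (Fin 3) (Fin 3) ℝ :=
  Matrix.of fun i j => (![F.t s, F.n s, F.b s] j) i

/-- The signed weak curvature `κ = t' · n` on `(0, L)`. -/
def curvature (L : ℝ) (F : Frame) (s : ℝ) : ℝ := inner ℝ (weakDeriv L F.t s) (F.n s)

/-- The weak torsion `τ = n' · b` on `(0, L)`. -/
def torsion (L : ℝ) (F : Frame) (s : ℝ) : ℝ := inner ℝ (weakDeriv L F.n s) (F.b s)

/-- The admissible class `W`. An element of `W^{1,p}((0, L); SO(3))` is given through its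
continuous representative on `[0, L]`, so that traces at the end points are values. -/
structure IsAdmissible (L p : ℝ) (F : Frame) : Prop where
  continuousOn_t : ContinuousOn F.t (Icc 0 L)
  continuousOn_n : ContinuousOn F.n (Icc 0 L)
  continuousOn_b : ContinuousOn F.b (Icc 0 L)
  sobolev_t : MemSobolev L (ENNReal.ofReal p) 1 F.t
  sobolev_n : MemSobolev L (ENNReal.ofReal p) 1 F.n
  sobolev_b : MemSobolev L (ENNReal.ofReal p) 1 F.b
  rotation : ∀ s ∈ Icc 0 L, F.toMatrix s ∈ Matrix.specialOrthogonalGroup (Fin 3) ℝ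
  deriv_t_inner_b : ∀ᵐ s ∂volume.restrict (Ioo 0 L), inner ℝ (weakDeriv L F.t s) (F.b s) = 0
  integral_t : ∫ s in Ioo 0 L, F.t s = 0
  tangent_closed : F.t L = F.t 0

/-- The Euler energy `∫₀ᴸ κ² ds`, with values in `[0, +∞]`. -/
def eulerEnergy (L : ℝ) (F : Frame) : ℝ≥0∞ :=
  ∫⁻ s in Ioo 0 L, ENNReal.ofReal (F.curvature L s ^ 2)

/-- `F` minimizes the Euler energy on the admissible class `W`. -/
def IsEulerMinimizer (L p : ℝ) (F : Frame) : Prop :=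
  F.IsAdmissible L p ∧ ∀ G : Frame, G.IsAdmissible L p → F.eulerEnergy L ≤ G.eulerEnergy L

end Frame

end

noncomputable section

/-! ### Weak derivatives on an interval -/

/-! The minimizers can be determined explicitly, so no Euler–Lagrange equation is derived. Since `t`
is a unit vector and `t'` is orthogonal to both `t` and `b`, we have `t' = κ n`, and the energy is
`∫ |t'|²`. Each coordinate of `t` is periodic with mean zero, so Wirtinger's inequality gives `∫
|t'|² ≥ (2π/L)² ∫ |t|² = (2π/L)² L`, which is exactly the energy of the circle of length `L`. A
minimizer does no worse than the circle, so equality holds in every coordinate.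

The equality case (`eq_cos_add_sin_of_wirtinger`, by Parseval) forces `t = cos(ws) A + sin(ws) B`
with `w = 2π/L` (`Frame.IsAdmissible.exists_eq_harmonicCurve`). Then `|t'| = w` everywhere. The
function `t' · n` is continuous with constant square, so it is a constant `c = ±w`. Hence `n =
t'/c`, `n'` is parallel to `t`, and the torsion vanishes
(`Frame.IsAdmissible.exists_curvature_torsion_eq`). With `κ = c ≠ 0` and `τ = 0`, the assertions
hold for `c₁ = c²` and `c₂ = 0`. -/

theorem intervalIntegral_eq_integral_Ioo {E : Type*} [NormedAddCommGroup E] [NormedSpace ℝ E]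
    {L : ℝ} (hL : 0 ≤ L) (f : ℝ → E) : ∫ x in (0 : ℝ)..L, f x = ∫ x in Ioo 0 L, f x := by
  rw [intervalIntegral.integral_of_le hL, integral_Ioc_eq_integral_Ioo]

/-- Integration by parts for a primitive of an integrable function. -/
theorem integral_deriv_mul_primitive {L c : ℝ} (hL : 0 ≤ L) {f g h h' : ℝ → ℝ}
    (hg : IntervalIntegrable g volume 0 L)
    (hf : ∀ x ∈ Icc 0 L, f x = c + ∫ y in (0 : ℝ)..x, g y)
    (hh : ∀ x, HasDerivAt h (h' x) x) (hh' : Continuous h') :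
    ∫ x in (0 : ℝ)..L, h' x * f x =
      h L * f L - h 0 * f 0 - ∫ x in (0 : ℝ)..L, h x * g x := by
  have hd : deriv h = h' := funext fun x => (hh x).deriv
  have hac : AbsolutelyContinuousOnInterval (fun x => c + ∫ y in (0 : ℝ)..x, g y) 0 L :=
    (LipschitzWith.const c).lipschitzOnWith.absolutelyContinuousOnInterval.fun_add
      (hg.absolutelyContinuousOnInterval_intervalIntegral left_mem_uIcc)
  have hhac : AbsolutelyContinuousOnInterval h 0 L := by
    refine ContDiffOn.absolutelyContinuousOnInterval (ContDiff.contDiffOn ?_)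
    rw [contDiff_one_iff_deriv, hd]
    exact ⟨fun x => (hh x).differentiableAt, hh'⟩
  have key := hac.integral_mul_deriv_eq_deriv_mul hhac
  rw [hd, ← hf L (right_mem_Icc.2 hL), ← hf 0 (left_mem_Icc.2 hL)] at key
  have e1 : ∫ x in (0 : ℝ)..L, h' x * f x =
      ∫ x in (0 : ℝ)..L, (c + ∫ y in (0 : ℝ)..x, g y) * h' x := by
    refine intervalIntegral.integral_congr fun x hx => ?_
    rw [uIcc_of_le hL] at hx
    simp only [hf x hx, mul_comm]
  -- The primitive has derivative `g` only almost everywhere, by Lebesgue differentiation.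
  have e2 : ∫ x in (0 : ℝ)..L, h x * g x =
      ∫ x in (0 : ℝ)..L, deriv (fun x => c + ∫ y in (0 : ℝ)..x, g y) x * h x := by
    refine intervalIntegral.integral_congr_ae ?_
    filter_upwards [hg.ae_hasDerivAt_integral] with x hx hx'
    rw [((hx (uIoc_subset_uIcc hx') 0 left_mem_uIcc).const_add c).deriv, mul_comm]
  rw [e1, e2, key]
  ring

theorem exists_Icc_of_isCompact_subset_Ioo {L : ℝ} {K : Set ℝ} (hL : 0 < L)
    (hK : IsCompact K) (hKL : K ⊆ Ioo 0 L) : ∃ a b, 0 < a ∧ b < L ∧ K ⊆ Icc a b := by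
  rcases K.eq_empty_or_nonempty with rfl | hne
  · exact ⟨L, 0, hL, hL, empty_subset _⟩
  · exact ⟨sInf K, sSup K, (hKL (hK.sInf_mem hne)).1, (hKL (hK.sSup_mem hne)).2,
      fun x hx => ⟨csInf_le hK.bddBelow hx, le_csSup hK.bddAbove hx⟩⟩

/-- Local integrability says nothing near the end points; a test function cuts these away, so that
integrals against it may be split. -/
theorem MeasureTheory.LocallyIntegrableOn.integrableOn_smul_of_tsupport_subset {E : Type*}
    [NormedAddCommGroup E] [NormedSpace ℝ E] {L : ℝ} {φ : ℝ → ℝ} {u : ℝ → E}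
    (hu : LocallyIntegrableOn u (Ioo 0 L)) (hφ : Continuous φ) (hc : HasCompactSupport φ)
    (hs : tsupport φ ⊆ Ioo 0 L) : IntegrableOn (fun s => φ s • u s) (Ioo 0 L) := by
  have h1 : IntegrableOn (fun s => φ s • u s) (tsupport φ) :=
    (hu.integrableOn_compact_subset hs hc).continuousOn_smul hφ.continuousOn hc
  refine h1.of_forall_sdiff_eq_zero measurableSet_Ioo fun x hx => ?_
  rw [image_eq_zero_of_notMem_tsupport hx.2, zero_smul]

theorem ContinuousOn.locallyIntegrableOn_Ioo {E : Type*} [NormedAddCommGroup E]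
    {L : ℝ} {u : ℝ → E} (hu : ContinuousOn u (Icc 0 L)) : LocallyIntegrableOn u (Ioo 0 L) :=
  (hu.integrableOn_Icc.mono_set Ioo_subset_Icc_self).locallyIntegrableOn

/-- The primitive of a test function of mean zero is a test function. -/
theorem exists_primitive_test {L : ℝ} (hL : 0 < L) {η : ℝ → ℝ} (hη : ContDiff ℝ ∞ η)
    (hc : HasCompactSupport η) (hs : tsupport η ⊆ Ioo 0 L) (h0 : ∫ x in Ioo 0 L, η x = 0) :
    ∃ φ : ℝ → ℝ, ContDiff ℝ ∞ φ ∧ HasCompactSupport φ ∧ tsupport φ ⊆ Ioo 0 L ∧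
      deriv φ = η := by
  obtain ⟨a, b, ha, hb, hK⟩ := exists_Icc_of_isCompact_subset_Ioo hL hc hs
  have hz : ∀ x ∉ Icc a b, η x = 0 := fun x hx =>
    image_eq_zero_of_notMem_tsupport fun h => hx (hK h)
  have hd : ∀ x, HasDerivAt (fun x => ∫ y in (0 : ℝ)..x, η y) (η x) x := fun x =>
    intervalIntegral.integral_hasDerivAt_right (hη.continuous.intervalIntegrable _ _)
      hη.continuous.aestronglyMeasurable.stronglyMeasurableAtFilter hη.continuous.continuousAt
  have hder : deriv (fun x => ∫ y in (0 : ℝ)..x, η y) = η := funext fun x => (hd x).deriv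
  -- To the left of the support this is trivial; to the right the whole integral of `η` has been
  -- collected, and it is zero.
  have hsup : ∀ x ∉ Icc a b, ∫ y in (0 : ℝ)..x, η y = 0 := by
    intro x hx
    rcases lt_or_ge x a with h | h
    · refine (intervalIntegral.integral_congr (g := fun _ => 0) fun y hy => hz y ?_).trans
        (by simp)
      rintro ⟨h1, -⟩
      have := hy.2
      rcases le_max_iff.1 (le_trans h1 this) with h2 | h2 <;> linarith
    · have hbx : b < x := not_le.1 fun h' => hx ⟨h, h'⟩
      have e1 : ∫ y in (0 : ℝ)..L, η y = 0 := by
        rw [intervalIntegral.integral_of_le hL.le, integral_Ioc_eq_integral_Ioo, h0]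
      have e2 : ∫ y in L..x, η y = 0 := by
        refine (intervalIntegral.integral_congr (g := fun _ => 0) fun y hy => hz y ?_).trans
          (by simp)
        rintro ⟨-, h1⟩
        have := hy.1
        rcases min_le_iff.1 (le_trans this h1) with h2 | h2 <;> linarith
      rw [← intervalIntegral.integral_add_adjacent_intervals
        (hη.continuous.intervalIntegrable 0 L) (hη.continuous.intervalIntegrable L x), e1, e2,
        add_zero]
  refine ⟨fun x => ∫ y in (0 : ℝ)..x, η y, ?_, HasCompactSupport.intro isCompact_Icc hsup, ?_,
    hder⟩
  · rw [contDiff_infty_iff_deriv, hder]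
    exact ⟨fun x => (hd x).differentiableAt, hη⟩
  · refine (closure_minimal (fun x hx => ?_) isClosed_Icc).trans (Icc_subset_Ioo ha hb)
    exact not_imp_comm.1 (hsup x) hx

/-- The **du Bois-Reymond lemma**. -/
theorem eqOn_const_of_integral_deriv_mul_eq_zero {L : ℝ} (hL : 0 < L) {w : ℝ → ℝ}
    (hw : ContinuousOn w (Icc 0 L))
    (h : ∀ φ : ℝ → ℝ, ContDiff ℝ ∞ φ → HasCompactSupport φ → tsupport φ ⊆ Ioo 0 L →
      ∫ s in Ioo 0 L, deriv φ s * w s = 0) :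
    ∃ c, ∀ x ∈ Icc 0 L, w x = c := by
  -- A fixed test function of integral one, used to correct the mean of an arbitrary one.
  let B : ContDiffBump (L / 2) := ⟨L / 8, L / 4, by linarith, by linarith⟩
  have hBs : tsupport (B.normed volume) ⊆ Ioo 0 L := by
    rw [B.tsupport_normed_eq, Real.closedBall_eq_Icc]
    exact Icc_subset_Ioo (by change 0 < L / 2 - L / 4; linarith)
      (by change L / 2 + L / 4 < L; linarith)
  have hBc : HasCompactSupport (B.normed volume) := B.hasCompactSupport_normed
  have hBd : ContDiff ℝ ∞ (B.normed volume) := B.contDiff_normed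
  have hB1 : ∫ x in Ioo 0 L, B.normed volume x = 1 := by
    rw [setIntegral_eq_integral_of_forall_compl_eq_zero, B.integral_normed]
    exact fun x hx => image_eq_zero_of_notMem_tsupport fun h => hx (hBs h)
  set χ := B.normed volume
  have hwl := hw.locallyIntegrableOn_Ioo
  refine ⟨∫ s in Ioo 0 L, χ s * w s, ?_⟩
  set c := ∫ s in Ioo 0 L, χ s * w s
  have hae : ∀ᵐ x ∂volume, x ∈ Ioo 0 L → w x - c = 0 := by
    refine isOpen_Ioo.ae_eq_zero_of_integral_contDiff_smul_eq_zero
      (hw.sub continuousOn_const).locallyIntegrableOn_Ioo fun ψ hψ hψc hψs => ?_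
    rw [← setIntegral_eq_integral_of_forall_compl_eq_zero (s := Ioo 0 L)]
    swap
    · intro x hx
      rw [image_eq_zero_of_notMem_tsupport fun h => hx (hψs h), zero_smul]
    set m := ∫ x in Ioo 0 L, ψ x with hm
    have iψ : IntegrableOn ψ (Ioo 0 L) :=
      (hψ.continuous.integrable_of_hasCompactSupport hψc).integrableOn
    have iχ : IntegrableOn χ (Ioo 0 L) :=
      (hBd.continuous.integrable_of_hasCompactSupport hBc).integrableOn
    have iψw : IntegrableOn (fun s => ψ s * w s) (Ioo 0 L) :=
      hwl.integrableOn_smul_of_tsupport_subset hψ.continuous hψc hψs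
    have iχw : IntegrableOn (fun s => χ s * w s) (Ioo 0 L) :=
      hwl.integrableOn_smul_of_tsupport_subset hBd.continuous hBc hBs
    -- `ψ - m χ` has mean zero, hence is the derivative of a test function, and the hypothesis
    -- applies to it.
    obtain ⟨φ, h1, h2, h3, h4⟩ := exists_primitive_test hL (η := fun x => ψ x - m * χ x)
      (hψ.sub (contDiff_const.mul hBd)) (hψc.sub (hBc.mul_left))
      ((closure_minimal (fun x hx => by
          by_contra hx'
          rw [mem_union, not_or] at hx'
          exact hx (by simp [image_eq_zero_of_notMem_tsupport hx'.1,
            image_eq_zero_of_notMem_tsupport hx'.2]))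
        ((isClosed_tsupport ψ).union (isClosed_tsupport χ))).trans (union_subset hψs hBs))
      (by rw [integral_sub iψ (iχ.const_mul m), integral_const_mul, hB1, ← hm]; ring)
    have h5 := h φ h1 h2 h3
    rw [h4] at h5
    have e1 : ∀ s, (ψ s - m * χ s) * w s = ψ s * w s - m * (χ s * w s) := fun s => by ring
    have e2 : ∀ s, ψ s • (w s - c) = ψ s * w s - c * ψ s := fun s => by
      rw [smul_eq_mul]; ring
    simp_rw [e1] at h5
    rw [integral_sub iψw (iχw.const_mul m), integral_const_mul] at h5
    simp_rw [e2]
    rw [integral_sub iψw (iψ.const_mul c), integral_const_mul, ← hm]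
    linarith
  refine Measure.eqOn_Icc_of_ae_eq volume hL.ne ?_ hw continuousOn_const
  rw [← restrict_Ioo_eq_restrict_Icc]
  refine (ae_restrict_iff' measurableSet_Ioo).2 ?_
  filter_upwards [hae] with x hx hx'
  exact sub_eq_zero.1 (hx hx')

/-! ### Calculus of weak derivatives -/

namespace IsWeakDeriv

variable {E : Type*} [NormedAddCommGroup E] [NormedSpace ℝ E] {L : ℝ} {u v g h : ℝ → E}

theorem congr (hu : IsWeakDeriv L u g) (huv : v =ᵐ[volume.restrict (Ioo 0 L)] u)
    (hgh : h =ᵐ[volume.restrict (Ioo 0 L)] g) : IsWeakDeriv L v h where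
  locallyIntegrable := hu.locallyIntegrable.congr huv.symm
  locallyIntegrable_deriv := hu.locallyIntegrable_deriv.congr hgh.symm
  integral_eq φ h1 h2 h3 := by
    rw [integral_congr_ae (g := fun s => deriv φ s • u s)
      (huv.mono fun x hx => by simp only [hx]), hu.integral_eq φ h1 h2 h3,
      integral_congr_ae (f := fun s => φ s • h s) (g := fun s => φ s • g s)
      (hgh.mono fun x hx => by simp only [hx])]

/-- The difference annihilates every test function. This is what allows the chosen `weakDeriv` to be
computed from any explicit candidate. -/
theorem ae_unique [CompleteSpace E] (hg : IsWeakDeriv L u g) (hh : IsWeakDeriv L u h) :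
    g =ᵐ[volume.restrict (Ioo 0 L)] h := by
  have key := isOpen_Ioo.ae_eq_zero_of_integral_contDiff_smul_eq_zero
    (hg.locallyIntegrable_deriv.sub hh.locallyIntegrable_deriv) (fun φ h1 h2 h3 => by
      rw [← setIntegral_eq_integral_of_forall_compl_eq_zero (s := Ioo 0 L)]
      swap
      · intro x hx
        rw [image_eq_zero_of_notMem_tsupport fun h => hx (h3 h), zero_smul]
      simp only [Pi.sub_apply, smul_sub]
      rw [integral_sub
        (hg.locallyIntegrable_deriv.integrableOn_smul_of_tsupport_subset h1.continuous h2 h3)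
        (hh.locallyIntegrable_deriv.integrableOn_smul_of_tsupport_subset h1.continuous h2 h3)]
      have e1 := hg.integral_eq φ h1 h2 h3
      have e2 := hh.integral_eq φ h1 h2 h3
      rw [e1, neg_inj] at e2
      rw [e2, sub_self])
  refine (ae_restrict_iff' measurableSet_Ioo).2 ?_
  filter_upwards [key] with x hx hx'
  exact sub_eq_zero.1 (hx hx')

theorem weakDeriv (hu : IsWeakDeriv L u g) : IsWeakDeriv L u (weakDeriv L u) := by
  have hex : ∃ g, IsWeakDeriv L u g := ⟨g, hu⟩
  rw [_root_.weakDeriv, dif_pos hex]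
  exact hex.choose_spec

theorem weakDeriv_ae_eq [CompleteSpace E] (hu : IsWeakDeriv L u g) :
    _root_.weakDeriv L u =ᵐ[volume.restrict (Ioo 0 L)] g :=
  hu.weakDeriv.ae_unique hu

theorem clm_comp [CompleteSpace E] {F : Type*} [NormedAddCommGroup F] [NormedSpace ℝ F]
    [CompleteSpace F]
    (hu : IsWeakDeriv L u g) (A : E →L[ℝ] F) :
    IsWeakDeriv L (fun s => A (u s)) (fun s => A (g s)) where
  locallyIntegrable x hx := by
    obtain ⟨U, hU, hi⟩ := hu.locallyIntegrable x hx
    exact ⟨U, hU, A.integrable_comp hi⟩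
  locallyIntegrable_deriv x hx := by
    obtain ⟨U, hU, hi⟩ := hu.locallyIntegrable_deriv x hx
    exact ⟨U, hU, A.integrable_comp hi⟩
  integral_eq φ h1 h2 h3 := by
    have i1 : IntegrableOn (fun s => deriv φ s • u s) (Ioo 0 L) :=
      hu.locallyIntegrable.integrableOn_smul_of_tsupport_subset
        (contDiff_infty_iff_deriv.1 h1).2.continuous h2.deriv
        ((closure_minimal (support_deriv_subset) (isClosed_tsupport φ)).trans h3)
    have i2 : IntegrableOn (fun s => φ s • g s) (Ioo 0 L) :=
      hu.locallyIntegrable_deriv.integrableOn_smul_of_tsupport_subset h1.continuous h2 h3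
    simp only [← map_smul]
    rw [A.integral_comp_comm i1, A.integral_comp_comm i2, hu.integral_eq φ h1 h2 h3, map_neg]

theorem of_hasDerivAt [CompleteSpace E] (hL : 0 ≤ L) (hu : ∀ x, HasDerivAt u (g x) x)
    (hg : Continuous g) : IsWeakDeriv L u g where
  locallyIntegrable := (continuous_iff_continuousAt.2 fun x =>
    (hu x).continuousAt).continuousOn.locallyIntegrableOn_Ioo
  locallyIntegrable_deriv := hg.continuousOn.locallyIntegrableOn_Ioo
  integral_eq φ h1 h2 h3 := by
    have hφ := contDiff_infty_iff_deriv.1 h1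
    have key := intervalIntegral.integral_smul_deriv_eq_deriv_smul (a := 0) (b := L)
      (fun x _ => (hφ.1 x).hasDerivAt) (fun x _ => hu x)
      (hφ.2.continuous.intervalIntegrable _ _) (hg.intervalIntegrable _ _)
    rw [image_eq_zero_of_notMem_tsupport fun h => (h3 h).1.false,
      image_eq_zero_of_notMem_tsupport fun h => (h3 h).2.false,
      intervalIntegral.integral_of_le hL, intervalIntegral.integral_of_le hL,
      integral_Ioc_eq_integral_Ioo, integral_Ioc_eq_integral_Ioo] at key
    simp [key]

/-- The fundamental theorem of calculus for the continuous representative of a Sobolev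
function. -/
theorem eq_add_integral (hL : 0 < L) {f f' : ℝ → ℝ} (hf : IsWeakDeriv L f f')
    (hc : ContinuousOn f (Icc 0 L)) (hi : IntegrableOn f' (Ioo 0 L)) :
    ∀ x ∈ Icc 0 L, f x = f 0 + ∫ y in (0 : ℝ)..x, f' y := by
  have hii : IntervalIntegrable f' volume 0 L :=
    (intervalIntegrable_iff_integrableOn_Ioo_of_le hL.le).2 hi
  have hvc : ContinuousOn (fun x => ∫ y in (0 : ℝ)..x, f' y) (Icc 0 L) := by
    have := intervalIntegral.continuousOn_primitive_interval
      (μ := volume) (f := f') (a := 0) (b := L)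
      (by rwa [uIcc_of_le hL.le, integrableOn_Icc_iff_integrableOn_Ioo])
    rwa [uIcc_of_le hL.le] at this
  -- `f` minus the primitive of `f'` has weak derivative zero, so the du Bois-Reymond lemma makes it
  -- constant.
  obtain ⟨c, hcst⟩ := eqOn_const_of_integral_deriv_mul_eq_zero hL (hc.sub hvc)
    (fun φ h1 h2 h3 => by
      have hφ := contDiff_infty_iff_deriv.1 h1
      have e1 := hf.integral_eq φ h1 h2 h3
      have e2 := integral_deriv_mul_primitive (c := 0) hL.le hii
        (f := fun x => ∫ y in (0 : ℝ)..x, f' y) (fun x _ => (zero_add _).symm)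
        (fun x => (hφ.1 x).hasDerivAt) hφ.2.continuous
      rw [image_eq_zero_of_notMem_tsupport fun h => (h3 h).1.false,
        image_eq_zero_of_notMem_tsupport fun h => (h3 h).2.false] at e2
      simp only [intervalIntegral_eq_integral_Ioo hL.le, zero_mul] at e2
      have hs : tsupport (deriv φ) ⊆ Ioo 0 L :=
        (closure_minimal support_deriv_subset (isClosed_tsupport φ)).trans h3
      simp only [Pi.sub_apply, ← smul_eq_mul, smul_sub]
      rw [integral_sub
        (hc.locallyIntegrableOn_Ioo.integrableOn_smul_of_tsupport_subset
          hφ.2.continuous h2.deriv hs)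
        (hvc.locallyIntegrableOn_Ioo.integrableOn_smul_of_tsupport_subset
          hφ.2.continuous h2.deriv hs), e1]
      simp only [smul_eq_mul]
      rw [e2]
      ring)
  intro x hx
  have a1 := hcst x hx
  have a2 := hcst 0 (left_mem_Icc.2 hL.le)
  simp only [Pi.sub_apply, intervalIntegral.integral_same] at a1 a2
  linarith

end IsWeakDeriv
/-! ### Wirtinger's inequality with its equality case -/

theorem fourier_neg_coe_eq {T L : ℝ} (hT : T = L) (n : ℤ) (x : ℝ) :
    fourier (-n) (x : AddCircle T) =
      ((Real.cos (n * (2 * Real.pi / L) * x) : ℝ) : ℂ) -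
        Complex.I * ((Real.sin (n * (2 * Real.pi / L) * x) : ℝ) : ℂ) := by
  have e : 2 * (Real.pi : ℂ) * Complex.I * ((-n : ℤ) : ℂ) * x / (T : ℂ) =
      ((-(n * (2 * Real.pi / L) * x) : ℝ) : ℂ) * Complex.I := by
    rw [hT]
    push_cast
    ring
  rw [fourier_coe_apply, e, Complex.exp_mul_I, ← Complex.ofReal_cos, ← Complex.ofReal_sin,
    Real.cos_neg, Real.sin_neg]
  push_cast
  ring

theorem fourierCoeffOn_ofReal {L : ℝ} (hL : 0 < L) {f : ℝ → ℝ}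
    (hf : IntervalIntegrable f volume 0 L) (n : ℤ) :
    fourierCoeffOn hL (fun x => (f x : ℂ)) n = ((L⁻¹ : ℝ) : ℂ) *
      (((∫ x in (0 : ℝ)..L, Real.cos (n * (2 * Real.pi / L) * x) * f x : ℝ) : ℂ) -
        Complex.I * ((∫ x in (0 : ℝ)..L, Real.sin (n * (2 * Real.pi / L) * x) * f x : ℝ) : ℂ)) := by
  have i1 : IntervalIntegrable (fun x => Real.cos (n * (2 * Real.pi / L) * x) * f x) volume 0 L :=
    hf.continuousOn_mul (by fun_prop)
  have i2 : IntervalIntegrable (fun x => Real.sin (n * (2 * Real.pi / L) * x) * f x) volume 0 L :=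
    hf.continuousOn_mul (by fun_prop)
  have j1 : IntervalIntegrable
      (fun x => ((Real.cos (n * (2 * Real.pi / L) * x) * f x : ℝ) : ℂ)) volume 0 L :=
    ⟨i1.1.ofReal, i1.2.ofReal⟩
  have j2 : IntervalIntegrable
      (fun x => ((Real.sin (n * (2 * Real.pi / L) * x) * f x : ℝ) : ℂ)) volume 0 L :=
    ⟨i2.1.ofReal, i2.2.ofReal⟩
  rw [fourierCoeffOn_eq_integral, ← intervalIntegral.integral_ofReal,
    ← intervalIntegral.integral_ofReal, ← intervalIntegral.integral_const_mul,
    ← intervalIntegral.integral_sub j1 (j2.const_mul _), Complex.real_smul, sub_zero, one_div]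
  congr 1
  refine intervalIntegral.integral_congr fun x _ => ?_
  simp only [fourier_neg_coe_eq (rfl : L = L) n x, smul_eq_mul]
  push_cast
  ring

/-- Integration by parts against cosine and sine; the boundary terms cancel because `f` and the
trigonometric functions take equal values at `0` and `L`. -/
theorem fourierCoeffOn_primitive {L : ℝ} (hL : 0 < L) {f g : ℝ → ℝ}
    (hg : IntervalIntegrable g volume 0 L)
    (hfi : IntervalIntegrable f volume 0 L)
    (hf : ∀ x ∈ Icc 0 L, f x = f 0 + ∫ y in (0 : ℝ)..x, g y) (hper : f L = f 0) (n : ℤ) :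
    fourierCoeffOn hL (fun x => (g x : ℂ)) n =
      ((n * (2 * Real.pi / L) : ℝ) : ℂ) * Complex.I * fourierCoeffOn hL (fun x => (f x : ℂ)) n := by
  rw [fourierCoeffOn_ofReal hL hg, fourierCoeffOn_ofReal hL hfi]
  set w : ℝ := n * (2 * Real.pi / L) with hw
  have hwL : w * L = n * (2 * Real.pi) := by rw [hw]; field_simp
  have hlin : ∀ x, HasDerivAt (fun x : ℝ => w * x) w x := fun x => by
    simpa using (hasDerivAt_id x).const_mul w
  have k1 := integral_deriv_mul_primitive hL.le hg hf (fun x => (hlin x).cos) (by fun_prop)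
  have k2 := integral_deriv_mul_primitive hL.le hg hf (fun x => (hlin x).sin) (by fun_prop)
  rw [hwL, Real.cos_int_mul_two_pi, mul_zero, Real.cos_zero, hper, sub_self, zero_sub] at k1
  have hsin : Real.sin (n * (2 * Real.pi)) = 0 := by
    rw [show (n : ℝ) * (2 * Real.pi) = ((2 * n : ℤ) : ℝ) * Real.pi by push_cast; ring,
      Real.sin_int_mul_pi]
  rw [hwL, hsin, mul_zero, Real.sin_zero, zero_mul, zero_mul, sub_self, zero_sub] at k2
  have q1 : ∫ x in (0 : ℝ)..L, -Real.sin (w * x) * w * f x =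
      -w * ∫ x in (0 : ℝ)..L, Real.sin (w * x) * f x := by
    rw [← intervalIntegral.integral_const_mul]
    exact intervalIntegral.integral_congr fun x _ => by ring
  have q2 : ∫ x in (0 : ℝ)..L, Real.cos (w * x) * w * f x =
      w * ∫ x in (0 : ℝ)..L, Real.cos (w * x) * f x := by
    rw [← intervalIntegral.integral_const_mul]
    exact intervalIntegral.integral_congr fun x _ => by ring
  rw [q1, neg_mul, neg_inj] at k1
  rw [q2, eq_comm, neg_eq_iff_eq_neg] at k2
  rw [← k1, k2]
  push_cast
  linear_combination ((L : ℂ)⁻¹ * w * ((∫ x in (0 : ℝ)..L, Real.sin (w * x) * f x : ℝ) : ℂ)) *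
    Complex.I_sq

/-- Parseval for `g` minus `(2π/L)²` times Parseval for `f`: the Wirtinger deficit becomes a series
whose signs are visible. -/
theorem hasSum_wirtinger {L : ℝ} (hL : 0 < L) {f g : ℝ → ℝ}
    (hg : MemLp g 2 (volume.restrict (Ioo 0 L))) (hfc : ContinuousOn f (Icc 0 L))
    (hf : ∀ x ∈ Icc 0 L, f x = f 0 + ∫ y in (0 : ℝ)..x, g y) (hper : f L = f 0) :
    HasSum (fun n : ℤ => (2 * Real.pi / L) ^ 2 * ((n : ℝ) ^ 2 - 1) *
        ‖fourierCoeffOn hL (fun x => (f x : ℂ)) n‖ ^ 2)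
      (L⁻¹ * ((∫ x in Ioo 0 L, g x ^ 2) - (2 * Real.pi / L) ^ 2 * ∫ x in Ioo 0 L, f x ^ 2)) := by
  have hgi : IntervalIntegrable g volume 0 L :=
    (intervalIntegrable_iff_integrableOn_Ioo_of_le hL.le).2 (hg.integrable one_le_two)
  have hfi : IntervalIntegrable f volume 0 L := hfc.intervalIntegrable_of_Icc hL.le
  have hf2 : MemLp f 2 (volume.restrict (Ioc 0 L)) := by
    obtain ⟨C, hC⟩ := isCompact_Icc.exists_bound_of_continuousOn hfc
    exact MemLp.of_bound hfi.1.aestronglyMeasurable C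
      ((ae_restrict_iff' measurableSet_Ioc).2 (Filter.Eventually.of_forall fun x hx =>
        hC x (Ioc_subset_Icc_self hx)))
  rw [restrict_Ioo_eq_restrict_Ioc] at hg
  have s1 := hasSum_sq_fourierCoeffOn hL hg.ofReal
  have s2 := hasSum_sq_fourierCoeffOn hL hf2.ofReal
  have s3 := s1.sub (s2.mul_left ((2 * Real.pi / L) ^ 2))
  simp only [Complex.coe_algebraMap, fourierCoeffOn_primitive hL hgi hfi hf hper,
    intervalIntegral_eq_integral_Ioo hL.le, norm_mul, Complex.norm_I, Complex.norm_real, mul_pow,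
    Real.norm_eq_abs, sq_abs, sub_zero, smul_eq_mul, mul_one] at s3
  have e1 : ∀ n : ℤ, (2 * Real.pi / L) ^ 2 * ((n : ℝ) ^ 2 - 1) *
      ‖fourierCoeffOn hL (fun x => (f x : ℂ)) n‖ ^ 2 =
      (n : ℝ) ^ 2 * (2 * Real.pi / L) ^ 2 * ‖fourierCoeffOn hL (fun x => (f x : ℂ)) n‖ ^ 2 -
      (2 * Real.pi / L) ^ 2 * ‖fourierCoeffOn hL (fun x => (f x : ℂ)) n‖ ^ 2 := fun n => by ring
  rw [funext e1, mul_sub, mul_left_comm L⁻¹]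
  exact s3

theorem fourierCoeffOn_zero_eq_zero {L : ℝ} (hL : 0 < L) {f : ℝ → ℝ}
    (hmean : ∫ x in Ioo 0 L, f x = 0) : fourierCoeffOn hL (fun x => (f x : ℂ)) 0 = 0 := by
  rw [fourierCoeffOn_eq_integral]
  simp [intervalIntegral_eq_integral_Ioo hL.le, integral_complex_ofReal, hmean]

/-- The factor `n² - 1` is negative only at `n = 0`, where mean zero kills the coefficient. -/
theorem wirtinger_term_nonneg {L : ℝ} {c : ℤ → ℂ} (h0 : c 0 = 0) (n : ℤ) :
    0 ≤ (2 * Real.pi / L) ^ 2 * ((n : ℝ) ^ 2 - 1) * ‖c n‖ ^ 2 := by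
  rcases eq_or_ne n 0 with rfl | hn
  · simp [h0]
  · have h1 : (1 : ℝ) ≤ (n : ℝ) ^ 2 := by
      have := Int.one_le_abs hn
      rw [← sq_abs]
      exact one_le_pow₀ (by exact_mod_cast this)
    have : 0 ≤ (n : ℝ) ^ 2 - 1 := by linarith
    positivity

/-- **Wirtinger's inequality** for periodic functions of mean zero. -/
theorem wirtinger_le {L : ℝ} (hL : 0 < L) {f g : ℝ → ℝ}
    (hg : MemLp g 2 (volume.restrict (Ioo 0 L))) (hfc : ContinuousOn f (Icc 0 L))
    (hf : ∀ x ∈ Icc 0 L, f x = f 0 + ∫ y in (0 : ℝ)..x, g y) (hper : f L = f 0)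
    (hmean : ∫ x in Ioo 0 L, f x = 0) :
    (2 * Real.pi / L) ^ 2 * ∫ x in Ioo 0 L, f x ^ 2 ≤ ∫ x in Ioo 0 L, g x ^ 2 := by
  have h := (hasSum_wirtinger hL hg hfc hf hper).nonneg
    (wirtinger_term_nonneg (fourierCoeffOn_zero_eq_zero hL hmean))
  have := nonneg_of_mul_nonneg_right h (inv_pos.2 hL)
  linarith

/-- A continuous periodic function whose Fourier coefficients vanish except for the frequencies
`1` and `-1`. -/
theorem eq_cos_add_sin_of_fourierCoeffOn {L : ℝ} (hL : 0 < L) {f : ℝ → ℝ}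
    (hfc : ContinuousOn f (Icc 0 L)) (hper : f L = f 0)
    (hc : ∀ n : ℤ, n ≠ 1 → n ≠ -1 → fourierCoeffOn hL (fun x => (f x : ℂ)) n = 0) :
    ∃ a b : ℝ, ∀ x ∈ Icc 0 L,
      f x = a * Real.cos (2 * Real.pi / L * x) + b * Real.sin (2 * Real.pi / L * x) := by
  have : Fact (0 < L) := ⟨hL⟩
  let φ : C(AddCircle L, ℂ) := ⟨AddCircle.liftIco L 0 (fun x => (f x : ℂ)),
    AddCircle.liftIco_zero_continuous (by simp [hper])
      (Complex.continuous_ofReal.comp_continuousOn hfc)⟩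
  have hcoef : ∀ n, fourierCoeff φ n = fourierCoeffOn hL (fun x => (f x : ℂ)) n := by
    intro n
    -- The lifted function is integrated up to `0 + L`, which is not syntactically `L`.
    have aux : ∀ b (hb : 0 < b), b = L → fourierCoeffOn hb (fun x => (f x : ℂ)) n =
        fourierCoeffOn hL (fun x => (f x : ℂ)) n := by
      rintro _ _ rfl
      rfl
    exact (fourierCoeff_liftIco_eq _ n).trans (aux _ _ (zero_add L))
  have hz : ∀ n ∉ ({1, -1} : Finset ℤ), fourierCoeff φ n = 0 := by
    intro n hn
    simp only [Finset.mem_insert, Finset.mem_singleton, not_or] at hn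
    rw [hcoef, hc n hn.1 hn.2]
  have hsum : Summable (fourierCoeff φ) := summable_of_ne_finset_zero hz
  set p := fourierCoeff φ 1
  set q := fourierCoeff φ (-1)
  have hIco : ∀ x ∈ Ico 0 L, f x = (p.re + q.re) * Real.cos (2 * Real.pi / L * x) +
      (q.im - p.im) * Real.sin (2 * Real.pi / L * x) := by
    intro x hx
    -- Finitely many nonzero coefficients and continuity on the circle give pointwise equality with
    -- the Fourier series, here a sum of two terms.
    have h1 := has_pointwise_sum_fourier_series_of_summable hsum (x : AddCircle L)
    have h2 := hasSum_sum_of_ne_finset_zero (L := .unconditional ℤ)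
      (f := fun i => fourierCoeff φ i • fourier i (x : AddCircle L)) (s := {1, -1})
      (fun n hn => by simp [hz n hn])
    have h3 := h1.unique h2
    have h4 : φ (x : AddCircle L) = (f x : ℂ) :=
      AddCircle.liftIco_zero_coe_apply (f := fun x => (f x : ℂ)) hx
    have e1 := fourier_neg_coe_eq (rfl : L = L) 1 x
    have e2 := fourier_neg_coe_eq (rfl : L = L) (-1) x
    simp only [neg_neg] at e1 e2
    rw [h4, Finset.sum_pair (by decide), e1, e2] at h3
    have h5 := congrArg Complex.re h3
    simp [-Complex.ofReal_cos, -Complex.ofReal_sin] at h5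
    rw [h5]
    ring
  refine ⟨p.re + q.re, q.im - p.im, fun x hx => ?_⟩
  rcases hx.2.eq_or_lt with rfl | hlt
  · rw [hper, hIco 0 ⟨le_rfl, hL⟩, div_mul_cancel₀ _ hL.ne']
    simp
  · exact hIco x ⟨hx.1, hlt⟩

/-- The equality case of Wirtinger's inequality. -/
theorem eq_cos_add_sin_of_wirtinger {L : ℝ} (hL : 0 < L) {f g : ℝ → ℝ}
    (hg : MemLp g 2 (volume.restrict (Ioo 0 L))) (hfc : ContinuousOn f (Icc 0 L))
    (hf : ∀ x ∈ Icc 0 L, f x = f 0 + ∫ y in (0 : ℝ)..x, g y) (hper : f L = f 0)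
    (hmean : ∫ x in Ioo 0 L, f x = 0)
    (heq : ∫ x in Ioo 0 L, g x ^ 2 ≤ (2 * Real.pi / L) ^ 2 * ∫ x in Ioo 0 L, f x ^ 2) :
    ∃ a b : ℝ, ∀ x ∈ Icc 0 L,
      f x = a * Real.cos (2 * Real.pi / L * x) + b * Real.sin (2 * Real.pi / L * x) := by
  have h0 := fourierCoeffOn_zero_eq_zero hL hmean
  have h := hasSum_wirtinger hL hg hfc hf hper
  -- Equality makes a series of nonnegative terms sum to zero, so every term vanishes; `n² - 1 ≠ 0`
  -- off `±1` then kills the coefficient.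
  rw [heq.antisymm (wirtinger_le hL hg hfc hf hper hmean), sub_self, mul_zero,
    hasSum_zero_iff_of_nonneg (wirtinger_term_nonneg h0)] at h
  refine eq_cos_add_sin_of_fourierCoeffOn hL hfc hper fun n h1 h2 => ?_
  have hn := congrFun h n
  have hw : (2 * Real.pi / L) ^ 2 ≠ 0 := by positivity
  have hn2 : (n : ℝ) ^ 2 - 1 ≠ 0 := by
    have h3 : (n : ℝ) ^ 2 - 1 = (n - 1) * (n + 1) := by ring
    rw [h3]
    exact mul_ne_zero (sub_ne_zero.2 (by exact_mod_cast h1))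
      (fun h4 => h2 (by exact_mod_cast eq_neg_of_add_eq_zero_left h4))
  simpa [hw, hn2] using hn

/-! ### Harmonic curves -/

/-- The curve `cos (w s) A + sin (w s) B`. -/
def harmonicCurve (w : ℝ) (A B : E3) (s : ℝ) : E3 :=
  Real.cos (w * s) • A + Real.sin (w * s) • B

theorem hasDerivAt_harmonicCurve (w : ℝ) (A B : E3) (s : ℝ) :
    HasDerivAt (harmonicCurve w A B) (w • harmonicCurve w B (-A) s) s := by
  have hlin : HasDerivAt (fun x : ℝ => w * x) w s := by
    simpa using (hasDerivAt_id s).const_mul w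
  refine ((hlin.cos.smul_const A).add (hlin.sin.smul_const B)).congr_deriv ?_
  simp only [harmonicCurve]
  module

theorem continuous_harmonicCurve (w : ℝ) (A B : E3) : Continuous (harmonicCurve w A B) := by
  unfold harmonicCurve
  fun_prop

theorem continuous_smul_harmonicCurve (c w : ℝ) (A B : E3) :
    Continuous fun s => c • harmonicCurve w A B s := by
  unfold harmonicCurve
  fun_prop

/-- The second curve is the first one advanced by a quarter period, so the cross terms cancel. If
the first has unit length throughout, its speed is therefore constant. -/
theorem inner_harmonicCurve_add (w : ℝ) (A B : E3) (s : ℝ) :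
    inner ℝ (harmonicCurve w A B s) (harmonicCurve w A B s) +
      inner ℝ (harmonicCurve w B (-A) s) (harmonicCurve w B (-A) s) =
      inner ℝ A A + inner ℝ B B := by
  simp only [harmonicCurve, inner_add_left, inner_add_right, real_inner_smul_left,
    real_inner_smul_right, inner_neg_left, inner_neg_right, real_inner_comm A B]
  linear_combination (inner ℝ A A + inner ℝ B B) * Real.sin_sq_add_cos_sq (w * s)

theorem integral_harmonicCurve {L : ℝ} (hL : 0 < L) (A B : E3) :
    ∫ s in Ioo 0 L, harmonicCurve (2 * Real.pi / L) A B s = 0 := by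
  have hw : 2 * Real.pi / L ≠ 0 := by positivity
  set w := 2 * Real.pi / L with hw'
  have hwL : w * L = 2 * Real.pi := by rw [hw']; field_simp
  rw [← intervalIntegral_eq_integral_Ioo hL.le, intervalIntegral.integral_eq_sub_of_hasDerivAt
    (f := fun s => w⁻¹ • harmonicCurve w (-B) A s)]
  · simp [harmonicCurve, hwL]
  · intro x _
    refine ((hasDerivAt_harmonicCurve w (-B) A x).const_smul w⁻¹).congr_deriv ?_
    rw [neg_neg, inv_smul_smul₀ hw]
  · exact (continuous_harmonicCurve w A B).intervalIntegrable _ _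

theorem memSobolev_one_of_hasDerivAt {E : Type*} [NormedAddCommGroup E] [NormedSpace ℝ E]
    [CompleteSpace E] {L : ℝ} (hL : 0 ≤ L) (q : ℝ≥0∞) {u g : ℝ → E}
    (hu : ∀ x, HasDerivAt u (g x) x) (hg : Continuous g) : MemSobolev L q 1 u := by
  have key : ∀ v : ℝ → E, Continuous v → MemLp v q (volume.restrict (Ioo 0 L)) := by
    intro v hv
    obtain ⟨C, hC⟩ := isCompact_Icc.exists_bound_of_continuousOn (hv.continuousOn (s := Icc 0 L))
    exact MemLp.of_bound
      ((hv.integrableOn_Icc (a := 0) (b := L)).mono_set Ioo_subset_Icc_self).aestronglyMeasurable C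
      ((ae_restrict_iff' measurableSet_Ioo).2 (Filter.Eventually.of_forall fun x hx =>
        hC x (Ioo_subset_Icc_self hx)))
  exact ⟨key u (continuous_iff_continuousAt.2 fun x => (hu x).continuousAt), g,
    IsWeakDeriv.of_hasDerivAt hL hu hg, key g hg⟩

theorem memSobolev_const {L : ℝ} (hL : 0 ≤ L) (q : ℝ≥0∞) (c : ℝ) :
    ∀ k, MemSobolev L q k (fun _ => c) := by
  intro k
  induction k generalizing c with
  | zero => exact memLp_const c
  | succ k ih => exact ⟨memLp_const c, fun _ => 0,
      IsWeakDeriv.of_hasDerivAt hL (fun x => hasDerivAt_const x c) continuous_const, ih 0⟩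

theorem MemSobolev.congr {E : Type*} [NormedAddCommGroup E] [NormedSpace ℝ E] {L : ℝ}
    {q : ℝ≥0∞} {u v : ℝ → E} (huv : u =ᵐ[volume.restrict (Ioo 0 L)] v) :
    ∀ {k : ℕ}, MemSobolev L q k u → MemSobolev L q k v
  | 0, h => MemLp.ae_eq huv h
  | _ + 1, ⟨h, g, hg, hk⟩ => ⟨MemLp.ae_eq huv h, g, hg.congr huv.symm (ae_eq_refl g), hk⟩

/-! ### Frames -/

namespace Frame

theorem inner_eq_sum (x y : E3) : inner ℝ x y = x 0 * y 0 + x 1 * y 1 + x 2 * y 2 := by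
  simp only [PiLp.inner_apply, Fin.sum_univ_three, RCLike.inner_apply, conj_trivial]
  ring

theorem orthonormal_of_rotation {F : Frame} {s : ℝ}
    (h : F.toMatrix s ∈ Matrix.specialOrthogonalGroup (Fin 3) ℝ) :
    inner ℝ (F.t s) (F.t s) = 1 ∧ inner ℝ (F.n s) (F.n s) = 1 ∧ inner ℝ (F.t s) (F.b s) = 0 := by
  have h1 := (Matrix.mem_orthogonalGroup_iff' _ _).1 (Matrix.mem_specialOrthogonalGroup_iff.1 h).1
  have e := fun i j => congrFun (congrFun h1 i) j
  have e00 := e 0 0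
  have e11 := e 1 1
  have e02 := e 0 2
  simp [Matrix.mul_apply, Fin.sum_univ_three, toMatrix] at e00 e11 e02
  simp only [inner_eq_sum]
  exact ⟨e00, e11, e02⟩

/-- The relation `M Mᵀ = 1` expresses completeness of the columns, so `v` equals its expansion in
the frame, where only the `n` term survives. -/
theorem eq_smul_of_rotation {F : Frame} {s : ℝ}
    (h : F.toMatrix s ∈ Matrix.specialOrthogonalGroup (Fin 3) ℝ) {v : E3}
    (ht : inner ℝ v (F.t s) = 0) (hb : inner ℝ v (F.b s) = 0) :
    v = (inner ℝ v (F.n s) : ℝ) • F.n s := by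
  have h1 := (Matrix.mem_orthogonalGroup_iff _ _).1 (Matrix.mem_specialOrthogonalGroup_iff.1 h).1
  have e := fun i j => congrFun (congrFun h1 i) j
  rw [inner_eq_sum] at ht hb
  ext i
  rw [inner_eq_sum]
  have e0 := e i 0
  have e1 := e i 1
  have e2 := e i 2
  obtain rfl | rfl | rfl : i = 0 ∨ i = 1 ∨ i = 2 := by fin_cases i <;> simp
  all_goals
    simp [Matrix.mul_apply, Fin.sum_univ_three, toMatrix] at e0 e1 e2 ⊢
    first
    | linear_combination F.t s 0 * ht + F.b s 0 * hb - v 0 * e0 - v 1 * e1 - v 2 * e2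
    | linear_combination F.t s 1 * ht + F.b s 1 * hb - v 0 * e0 - v 1 * e1 - v 2 * e2
    | linear_combination F.t s 2 * ht + F.b s 2 * hb - v 0 * e0 - v 1 * e1 - v 2 * e2

/-! ### The circle as competitor -/

/-- The Frenet frame of a circle of length `L`. -/
def circle (L : ℝ) : Frame where
  t := harmonicCurve (2 * Real.pi / L) (EuclideanSpace.single 0 1) (EuclideanSpace.single 1 1)
  n := harmonicCurve (2 * Real.pi / L) (EuclideanSpace.single 1 1) (-EuclideanSpace.single 0 1)
  b := fun _ => EuclideanSpace.single 2 1

theorem circle_rotation (L s : ℝ) :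
    (circle L).toMatrix s ∈ Matrix.specialOrthogonalGroup (Fin 3) ℝ := by
  have h := Real.sin_sq_add_cos_sq (2 * Real.pi / L * s)
  rw [Matrix.mem_specialOrthogonalGroup_iff, Matrix.mem_orthogonalGroup_iff']
  constructor
  · ext i j
    fin_cases i <;> fin_cases j <;>
      simp [Matrix.mul_apply, Fin.sum_univ_three, toMatrix, circle, harmonicCurve] <;>
      first | linear_combination h | ring
  · rw [Matrix.det_fin_three]
    simp [toMatrix, circle, harmonicCurve]
    linear_combination h

theorem circle_weakDeriv_t {L : ℝ} (hL : 0 < L) :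
    weakDeriv L (circle L).t =ᵐ[volume.restrict (Ioo 0 L)]
      fun s => (2 * Real.pi / L) • (circle L).n s :=
  (IsWeakDeriv.of_hasDerivAt hL.le (hasDerivAt_harmonicCurve _ _ _)
    (continuous_smul_harmonicCurve _ _ _ _)).weakDeriv_ae_eq

theorem circle_isAdmissible {L : ℝ} (hL : 0 < L) (p : ℝ) : (circle L).IsAdmissible L p where
  continuousOn_t := (continuous_harmonicCurve _ _ _).continuousOn
  continuousOn_n := (continuous_harmonicCurve _ _ _).continuousOn
  continuousOn_b := continuousOn_const
  sobolev_t := memSobolev_one_of_hasDerivAt hL.le _ (hasDerivAt_harmonicCurve _ _ _)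
    (continuous_smul_harmonicCurve _ _ _ _)
  sobolev_n := memSobolev_one_of_hasDerivAt hL.le _ (hasDerivAt_harmonicCurve _ _ _)
    (continuous_smul_harmonicCurve _ _ _ _)
  sobolev_b := memSobolev_one_of_hasDerivAt hL.le _ (fun x => hasDerivAt_const x _)
    continuous_const
  rotation s _ := circle_rotation L s
  deriv_t_inner_b := by
    filter_upwards [circle_weakDeriv_t hL] with s hs
    rw [hs, real_inner_smul_left, inner_eq_sum]
    simp [circle, harmonicCurve]
  integral_t := integral_harmonicCurve hL _ _
  tangent_closed := by
    simp [circle, harmonicCurve, div_mul_cancel₀ _ hL.ne']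

theorem circle_eulerEnergy {L : ℝ} (hL : 0 < L) :
    (circle L).eulerEnergy L = ENNReal.ofReal ((2 * Real.pi / L) ^ 2 * L) := by
  have h : (fun s => ENNReal.ofReal ((circle L).curvature L s ^ 2))
      =ᵐ[volume.restrict (Ioo 0 L)] fun _ => ENNReal.ofReal ((2 * Real.pi / L) ^ 2) := by
    filter_upwards [circle_weakDeriv_t hL] with s hs
    rw [curvature, hs, real_inner_smul_left, (orthonormal_of_rotation (circle_rotation L s)).2.1,
      mul_one]
  rw [eulerEnergy, lintegral_congr_ae h, lintegral_const, Measure.restrict_apply_univ,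
    Real.volume_Ioo, sub_zero, ENNReal.ofReal_mul (by positivity)]

/-! ### Rigidity of admissible frames of small energy -/

namespace IsAdmissible

variable {L p : ℝ} {F : Frame}

theorem isWeakDeriv_t (hF : F.IsAdmissible L p) : IsWeakDeriv L F.t (weakDeriv L F.t) := by
  obtain ⟨-, g, hg, -⟩ := hF.sobolev_t
  exact hg.weakDeriv

theorem integrableOn_weakDeriv_t (hp : 1 < p) (hF : F.IsAdmissible L p) :
    IntegrableOn (weakDeriv L F.t) (Ioo 0 L) := by
  obtain ⟨-, g, hg, hgp⟩ := hF.sobolev_t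
  have hgp : MemLp g (ENNReal.ofReal p) (volume.restrict (Ioo 0 L)) := hgp
  refine (hgp.integrable ?_).congr hg.weakDeriv_ae_eq.symm
  rw [← ENNReal.ofReal_one]
  exact ENNReal.ofReal_le_ofReal hp.le

theorem coord_eq_add_integral (hL : 0 < L) (hp : 1 < p) (hF : F.IsAdmissible L p) (i : Fin 3) :
    ∀ x ∈ Icc 0 L, F.t x i = F.t 0 i + ∫ y in (0 : ℝ)..x, weakDeriv L F.t y i := by
  have hW := hF.isWeakDeriv_t.clm_comp (EuclideanSpace.proj i : E3 →L[ℝ] ℝ)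
  exact hW.eq_add_integral hL
    ((EuclideanSpace.proj i : E3 →L[ℝ] ℝ).continuous.comp_continuousOn hF.continuousOn_t)
    ((EuclideanSpace.proj i : E3 →L[ℝ] ℝ).integrable_comp (hF.integrableOn_weakDeriv_t hp))

/-- Differentiate `|t|² = 1` at the points, almost all, where the three coordinates are classically
differentiable. -/
theorem ae_inner_weakDeriv_t_self (hL : 0 < L) (hp : 1 < p) (hF : F.IsAdmissible L p) :
    ∀ᵐ s ∂volume.restrict (Ioo 0 L), inner ℝ (weakDeriv L F.t s) (F.t s) = 0 := by
  have hi : ∀ i : Fin 3, IntervalIntegrable (fun s => weakDeriv L F.t s i) volume 0 L := fun i =>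
    (intervalIntegrable_iff_integrableOn_Ioo_of_le hL.le).2
      ((EuclideanSpace.proj i : E3 →L[ℝ] ℝ).integrable_comp (hF.integrableOn_weakDeriv_t hp))
  rw [ae_restrict_iff' measurableSet_Ioo]
  filter_upwards [(hi 0).ae_hasDerivAt_integral, (hi 1).ae_hasDerivAt_integral,
    (hi 2).ae_hasDerivAt_integral] with s h0 h1 h2 hs
  have hd : ∀ i : Fin 3, HasDerivAt (fun x => ∫ y in (0 : ℝ)..x, weakDeriv L F.t y i)
      (weakDeriv L F.t s i) s → HasDerivAt (fun x => F.t x i) (weakDeriv L F.t s i) s := by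
    intro i h
    refine (h.const_add (F.t 0 i)).congr_of_eventuallyEq ?_
    filter_upwards [Icc_mem_nhds hs.1 hs.2] with x hx
    exact hF.coord_eq_add_integral hL hp i x hx
  have hs' : s ∈ uIcc 0 L := by
    rw [uIcc_of_le hL.le]
    exact Ioo_subset_Icc_self hs
  have d0 := hd 0 (h0 hs' 0 left_mem_uIcc)
  have d1 := hd 1 (h1 hs' 0 left_mem_uIcc)
  have d2 := hd 2 (h2 hs' 0 left_mem_uIcc)
  have D := ((d0.mul d0).add (d1.mul d1)).add (d2.mul d2)
  have hc : HasDerivAt (fun _ : ℝ => (1 : ℝ)) 0 s := hasDerivAt_const s 1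
  have := D.unique (hc.congr_of_eventuallyEq (by
    filter_upwards [Icc_mem_nhds hs.1 hs.2] with x hx
    have := (orthonormal_of_rotation (hF.rotation x hx)).1
    rw [inner_eq_sum] at this
    exact this))
  rw [inner_eq_sum]
  linarith

theorem ae_weakDeriv_t_eq (hL : 0 < L) (hp : 1 < p) (hF : F.IsAdmissible L p) :
    ∀ᵐ s ∂volume.restrict (Ioo 0 L), weakDeriv L F.t s = F.curvature L s • F.n s := by
  filter_upwards [hF.ae_inner_weakDeriv_t_self hL hp, hF.deriv_t_inner_b,
    ae_restrict_mem measurableSet_Ioo] with s h1 h2 hs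
  exact eq_smul_of_rotation (hF.rotation s (Ioo_subset_Icc_self hs)) h1 h2

/-- An admissible frame whose energy is at most that of the circle has a harmonic tangent. -/
theorem exists_eq_harmonicCurve (hL : 0 < L) (hp : 1 < p) (hF : F.IsAdmissible L p)
    (hE : F.eulerEnergy L ≤ ENNReal.ofReal ((2 * Real.pi / L) ^ 2 * L)) :
    ∃ A B : E3, ∀ s ∈ Icc 0 L, F.t s = harmonicCurve (2 * Real.pi / L) A B s := by
  set g := weakDeriv L F.t with hg
  have hgi := hF.integrableOn_weakDeriv_t hp
  have hκm : AEStronglyMeasurable (F.curvature L) (volume.restrict (Ioo 0 L)) :=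
    hgi.aestronglyMeasurable.inner
      ((hF.continuousOn_n.mono Ioo_subset_Icc_self).aestronglyMeasurable measurableSet_Ioo)
  -- Square integrability comes from the energy bound; it does not follow from the Sobolev exponent,
  -- since `p < 2` is allowed.
  have hκi : IntegrableOn (fun s => F.curvature L s ^ 2) (Ioo 0 L) := by
    refine ⟨hκm.pow 2, ?_⟩
    rw [hasFiniteIntegral_iff_ofReal (Filter.Eventually.of_forall fun s => sq_nonneg _)]
    exact hE.trans_lt ENNReal.ofReal_lt_top
  have hκ : ∫ s in Ioo 0 L, F.curvature L s ^ 2 ≤ (2 * Real.pi / L) ^ 2 * L := by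
    rw [← ENNReal.ofReal_le_ofReal_iff (by positivity), ofReal_integral_eq_lintegral_ofReal hκi
      (Filter.Eventually.of_forall fun s => sq_nonneg _)]
    exact hE
  have hgκ : ∀ᵐ s ∂volume.restrict (Ioo 0 L),
      g s 0 ^ 2 + g s 1 ^ 2 + g s 2 ^ 2 = F.curvature L s ^ 2 := by
    filter_upwards [hF.ae_weakDeriv_t_eq hL hp, ae_restrict_mem measurableSet_Ioo] with s h hs
    have h1 := (orthonormal_of_rotation (hF.rotation s (Ioo_subset_Icc_self hs))).2.1
    have h2 : inner ℝ (g s) (g s) = F.curvature L s ^ 2 := by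
      rw [hg, h, real_inner_smul_left, real_inner_smul_right, h1]
      ring
    rw [inner_eq_sum] at h2
    rw [← h2]
    ring
  have hm : ∀ i : Fin 3, AEStronglyMeasurable (fun s => g s i) (volume.restrict (Ioo 0 L)) :=
    fun i => ((EuclideanSpace.proj i : E3 →L[ℝ] ℝ).integrable_comp hgi).aestronglyMeasurable
  have hsq : ∀ i : Fin 3, IntegrableOn (fun s => g s i ^ 2) (Ioo 0 L) := by
    intro i
    refine Integrable.mono' hκi ((hm i).pow 2) ?_
    filter_upwards [hgκ] with s hs
    rw [Real.norm_eq_abs, abs_of_nonneg (sq_nonneg _), ← hs]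
    have h0 := sq_nonneg (g s 0)
    have h1 := sq_nonneg (g s 1)
    have h2 := sq_nonneg (g s 2)
    fin_cases i <;> simp only [Fin.zero_eta, Fin.mk_one, Fin.reduceFinMk] <;> linarith
  have hL2 : ∀ i : Fin 3, MemLp (fun s => g s i) 2 (volume.restrict (Ioo 0 L)) :=
    fun i => (memLp_two_iff_integrable_sq (hm i)).2 (hsq i)
  have hc : ∀ i : Fin 3, ContinuousOn (fun s => F.t s i) (Icc 0 L) := fun i =>
    (EuclideanSpace.proj i : E3 →L[ℝ] ℝ).continuous.comp_continuousOn hF.continuousOn_t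
  have hti : IntegrableOn F.t (Ioo 0 L) :=
    hF.continuousOn_t.integrableOn_Icc.mono_set Ioo_subset_Icc_self
  have hmean : ∀ i : Fin 3, ∫ s in Ioo 0 L, F.t s i = 0 := by
    intro i
    have := (EuclideanSpace.proj i : E3 →L[ℝ] ℝ).integral_comp_comm hti
    rw [hF.integral_t, map_zero] at this
    exact this
  have hper : ∀ i : Fin 3, F.t L i = F.t 0 i := fun i => by rw [hF.tangent_closed]
  have hft : ∀ i : Fin 3, IntegrableOn (fun s => F.t s i ^ 2) (Ioo 0 L) := fun i =>
    ((hc i).pow 2).integrableOn_Icc.mono_set Ioo_subset_Icc_self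
  have sumg : (∫ s in Ioo 0 L, g s 0 ^ 2) + (∫ s in Ioo 0 L, g s 1 ^ 2) +
      (∫ s in Ioo 0 L, g s 2 ^ 2) ≤ (2 * Real.pi / L) ^ 2 * L := by
    have h01 : IntegrableOn (fun s => g s 0 ^ 2 + g s 1 ^ 2) (Ioo 0 L) := (hsq 0).add (hsq 1)
    rw [← integral_add (hsq 0) (hsq 1), ← integral_add h01 (hsq 2)]
    exact (integral_congr_ae hgκ).trans_le hκ
  have sumt : (∫ s in Ioo 0 L, F.t s 0 ^ 2) + (∫ s in Ioo 0 L, F.t s 1 ^ 2) +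
      (∫ s in Ioo 0 L, F.t s 2 ^ 2) = L := by
    have h01 : IntegrableOn (fun s => F.t s 0 ^ 2 + F.t s 1 ^ 2) (Ioo 0 L) := (hft 0).add (hft 1)
    rw [← integral_add (hft 0) (hft 1), ← integral_add h01 (hft 2),
      setIntegral_congr_fun (g := fun _ => (1 : ℝ)) measurableSet_Ioo]
    · simp [hL.le]
    · intro s hs
      have := (orthonormal_of_rotation (hF.rotation s (Ioo_subset_Icc_self hs))).1
      rw [inner_eq_sum] at this
      simp only [← this]
      ring
  have hw := fun i => wirtinger_le hL (hL2 i) (hc i) (hF.coord_eq_add_integral hL hp i)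
    (hper i) (hmean i)
  -- Each coordinate satisfies Wirtinger's inequality while the sum satisfies the reverse one, so no
  -- coordinate can be strict.
  have hle : ∀ i : Fin 3, ∫ s in Ioo 0 L, g s i ^ 2 ≤
      (2 * Real.pi / L) ^ 2 * ∫ s in Ioo 0 L, F.t s i ^ 2 := by
    have h0 := hw 0
    have h1 := hw 1
    have h2 := hw 2
    have e := congrArg ((2 * Real.pi / L) ^ 2 * ·) sumt
    simp only [mul_add] at e
    intro i
    fin_cases i <;> simp only [Fin.zero_eta, Fin.mk_one, Fin.reduceFinMk] <;> linarith
  choose a b hab using fun i => eq_cos_add_sin_of_wirtinger hL (hL2 i) (hc i)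
    (hF.coord_eq_add_integral hL hp i) (hper i) (hmean i) (hle i)
  refine ⟨WithLp.toLp 2 a, WithLp.toLp 2 b, fun s hs => ?_⟩
  ext i
  rw [hab i s hs]
  simp [harmonicCurve, mul_comm]

/-- Curvature and torsion of an admissible frame with harmonic tangent. -/
theorem exists_curvature_torsion_eq (hL : 0 < L) (hp : 1 < p) (hF : F.IsAdmissible L p)
    {A B : E3} (ht : ∀ s ∈ Icc 0 L, F.t s = harmonicCurve (2 * Real.pi / L) A B s) :
    ∃ c : ℝ, c ≠ 0 ∧ F.curvature L =ᵐ[volume.restrict (Ioo 0 L)] (fun _ => c) ∧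
      F.torsion L =ᵐ[volume.restrict (Ioo 0 L)] (fun _ => 0) := by
  have hw : 2 * Real.pi / L ≠ 0 := by positivity
  set w := 2 * Real.pi / L with hw'
  have hA : inner ℝ A A = 1 := by
    have h0 : (0 : ℝ) ∈ Icc 0 L := left_mem_Icc.2 hL.le
    have := (orthonormal_of_rotation (hF.rotation 0 h0)).1
    rw [ht 0 h0] at this
    simpa [harmonicCurve] using this
  have hB : inner ℝ B B = 1 := by
    -- A quarter period, where the curve passes through `B`.
    have h0 : L / 4 ∈ Icc 0 L := ⟨by positivity, by linarith⟩
    have := (orthonormal_of_rotation (hF.rotation _ h0)).1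
    have h4 : w * (L / 4) = Real.pi / 2 := by rw [hw']; field_simp; norm_num
    rw [ht _ h0, harmonicCurve, h4, Real.cos_pi_div_two, Real.sin_pi_div_two, zero_smul, one_smul,
      zero_add] at this
    exact this
  set T' : ℝ → E3 := fun s => w • harmonicCurve w B (-A) s with hT'
  have hT'c : Continuous T' := continuous_smul_harmonicCurve _ _ _ _
  have hT'n : ∀ s ∈ Icc 0 L, inner ℝ (T' s) (T' s) = w ^ 2 := by
    intro s hs
    have h1 := inner_harmonicCurve_add w A B s
    have h2 := (orthonormal_of_rotation (hF.rotation s hs)).1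
    rw [ht s hs] at h2
    rw [h2, hA, hB, add_right_inj] at h1
    simp only [hT', real_inner_smul_left, real_inner_smul_right, h1]
    ring
  have hder : weakDeriv L F.t =ᵐ[volume.restrict (Ioo 0 L)] T' := by
    refine ((IsWeakDeriv.of_hasDerivAt hL.le (hasDerivAt_harmonicCurve w A B) hT'c).congr ?_
      (ae_eq_refl _)).weakDeriv_ae_eq
    filter_upwards [ae_restrict_mem measurableSet_Ioo] with s hs
    exact ht s (Ioo_subset_Icc_self hs)
  set ν : ℝ → ℝ := fun s => inner ℝ (T' s) (F.n s) with hν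
  have hνc : ContinuousOn ν (Icc 0 L) := hT'c.continuousOn.inner hF.continuousOn_n
  have hκν : F.curvature L =ᵐ[volume.restrict (Ioo 0 L)] ν := by
    filter_upwards [hder] with s hs
    rw [curvature, hs]
  -- Both sides are continuous, so the almost everywhere identity `t' = κ n` holds everywhere.
  have hTν : EqOn T' (fun s => ν s • F.n s) (Icc 0 L) := by
    refine Measure.eqOn_Icc_of_ae_eq volume hL.ne ?_ hT'c.continuousOn
      (hνc.smul hF.continuousOn_n)
    rw [← restrict_Ioo_eq_restrict_Icc]
    filter_upwards [hder, hκν, hF.ae_weakDeriv_t_eq hL hp] with s h1 h2 h3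
    rw [← h1, h3, h2]
  have hνsq : EqOn (ν ^ 2) ((fun _ => w) ^ 2) (Icc 0 L) := by
    intro s hs
    have h1 := hT'n s hs
    rw [hTν hs, real_inner_smul_left, real_inner_smul_right,
      (orthonormal_of_rotation (hF.rotation s hs)).2.1, mul_one] at h1
    simp only [Pi.pow_apply, ← h1, sq]
  obtain ⟨c, hc2, hc⟩ : ∃ c, c ^ 2 = w ^ 2 ∧ ∀ s ∈ Icc 0 L, ν s = c := by
    -- A continuous function whose square is a nonzero constant cannot change sign on an interval.
    rcases isPreconnected_Icc.eq_or_eq_neg_of_sq_eq hνc continuousOn_const hνsq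
      (fun _ => hw) with h | h
    · exact ⟨w, rfl, h⟩
    · exact ⟨-w, by ring, h⟩
  have hc0 : c ≠ 0 := by
    rintro rfl
    exact hw (pow_eq_zero_iff two_ne_zero |>.1 (by rw [← hc2]; ring))
  refine ⟨c, hc0, ?_, ?_⟩
  · filter_upwards [hκν, ae_restrict_mem measurableSet_Ioo] with s h1 hs
    rw [h1, hc s (Ioo_subset_Icc_self hs)]
  -- Dividing `T' = c n` by `c` makes `n` harmonic too, so `n'` is a multiple of `-t`, which is
  -- orthogonal to `b`.
  · have hn : IsWeakDeriv L F.n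
        (fun s => c⁻¹ • w • w • harmonicCurve w (-A) (-B) s) := by
      refine (IsWeakDeriv.of_hasDerivAt hL.le (u := fun s => c⁻¹ • T' s)
        (fun s => ((hasDerivAt_harmonicCurve w B (-A) s).const_smul w).const_smul c⁻¹)
        (by unfold harmonicCurve; fun_prop)).congr ?_
        (ae_eq_refl _)
      filter_upwards [ae_restrict_mem measurableSet_Ioo] with s hs
      rw [hTν (Ioo_subset_Icc_self hs)]
      simp only [hc s (Ioo_subset_Icc_self hs)]
      rw [inv_smul_smul₀ hc0]
    filter_upwards [hn.weakDeriv_ae_eq, ae_restrict_mem measurableSet_Ioo] with s h1 hs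
    have hs' := Ioo_subset_Icc_self hs
    have h2 : harmonicCurve w (-A) (-B) s = -F.t s := by
      rw [ht s hs']
      simp only [harmonicCurve]
      module
    rw [torsion, h1, h2]
    simp only [real_inner_smul_left, inner_neg_left,
      (orthonormal_of_rotation (hF.rotation s hs')).2.2, neg_zero, mul_zero]

end IsAdmissible

end Frame

end

/-- The curvature and torsion are functions modulo almost everywhere equality on `(0, L)`; the
pointwise equations are stated for their continuous representatives `κ` and `τ`, with `κ` of
class `C²` on `[0, L]` (one-sided derivatives at the end points). -/
theorem mainTheorem3 (L p : ℝ) (hL : 0 < L) (hp : 1 < p) (F : Frame)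
    (hF : F.IsEulerMinimizer L p) :
    volume {s ∈ Icc 0 L | F.curvature L s = 0} = 0 ∧
    MemSobolev L 2 2 (F.curvature L) ∧
    MemSobolev L 2 1 (F.torsion L) ∧
    ∃ κ τ : ℝ → ℝ,
      ContDiffOn ℝ 2 κ (Icc 0 L) ∧
      ContinuousOn τ (Icc 0 L) ∧
      κ =ᵐ[volume.restrict (Ioo 0 L)] F.curvature L ∧
      τ =ᵐ[volume.restrict (Ioo 0 L)] F.torsion L ∧
      volume {s ∈ Icc 0 L | κ s = 0} = 0 ∧
      ∃ c₁ c₂ : ℝ, ∀ s ∈ Icc 0 L,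
        2 * iteratedDerivWithin 2 κ (Icc 0 L) s - 2 * κ s * τ s ^ 2 + κ s ^ 3 - c₁ * κ s = 0 ∧
        κ s ^ 2 * τ s = c₂ := by
  obtain ⟨hadm, hmin⟩ := hF
  have hE := hmin _ (Frame.circle_isAdmissible hL p)
  rw [Frame.circle_eulerEnergy hL] at hE
  obtain ⟨A, B, ht⟩ := hadm.exists_eq_harmonicCurve hL hp hE
  obtain ⟨c, hc0, hκ, hτ⟩ := hadm.exists_curvature_torsion_eq hL hp ht
  -- With `κ = c` and `τ = 0` the equation reduces to `c³ - c₁ c = 0`, whence `c₁ = c²`.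
  refine ⟨?_, (memSobolev_const hL.le 2 c 2).congr hκ.symm,
    (memSobolev_const hL.le 2 0 1).congr hτ.symm, fun _ => c, fun _ => 0, contDiffOn_const,
    continuousOn_const, hκ.symm, hτ.symm, ?_, c ^ 2, 0, fun s _ => ⟨?_, ?_⟩⟩
  · rw [restrict_Ioo_eq_restrict_Icc] at hκ
    have h := (ae_restrict_iff' measurableSet_Icc).1 hκ
    rw [ae_iff] at h
    refine measure_mono_null ?_ h
    rintro s ⟨h1, h2⟩ h'
    exact hc0 ((h' h1).symm.trans h2)
  · simp [hc0]
  · rw [iteratedDerivWithin_const]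
    simp only [OfNat.ofNat_ne_zero, if_false]
    ring
  · simp
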